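/- For topological spaces $X$ and $Y$, say that $X\times Y$ has UU (the uniquely universal property) if there is an open set $U\subseteq X\times Y$ such that for every open set $W\subseteq Y$ there is exactly one $x\in X$ with $U_x=\{y\in Y : (x,y)\in U\}=W$. Let $\omega^\omega$ be the Baire space and $2^\omega$ the Cantor space (products of discrete spaces). If $Y$ is a subspace of a Polish space and $Y$ is $\sigma$-compact but not compact, then $\omega^\omega\times Y$ has UU. In particular, $\omega^\omega\times(\mathbb Q\times 2^\omega)$ has UU, where $\mathbb Q$ carries its usual topology as a subspace of $\mathbb R$. -/

import Mathlib

/-- `X × Y` has the uniquely universal property (UU), with parameter space `X` and base space `Y`: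
there is an open set `U ⊆ X × Y` such that every open `W ⊆ Y` is the cross section
`U_x = {y | (x, y) ∈ U}` for exactly one `x : X`. -/
def HasUU (X Y : Type*) [TopologicalSpace X] [TopologicalSpace Y] : Prop :=
  ∃ U : Set (X × Y), IsOpen U ∧
    ∀ W : Set Y, IsOpen W → ∃! x : X, {y : Y | (x, y) ∈ U} = W

open Set Filter Topology

/-! An open set of `Y` is determined by the set of basic open sets it contains. These saturated
codes form a set `E` of points of `ℕ → Prop`, where `Prop` is Sierpiński, so that only positive
information is open and the evaluation relation is open. It thus suffices to find a continuous
bijection from the Baire space onto `E`, and to pull this relation back along it.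

Such a bijection needs two facts. By σ-compactness `E` is Borel (`measurableSet_saturatedCodes`). By
noncompactness every nonempty open subset of `E` is uncountable: a basis can be chosen so that
finitely many of its members lie in a proper open set with uncountably many open supersets
(`exists_injective_open_supersets`).

`exists_continuous_bijective_of_open_uncountable` does the rest. A partition into uncountable Borel
pieces is parametrized injectively up to a countable remainder; each remaining point is then
absorbed as the limit of its own sequence of pieces (`IsBaireImage.insert_iUnion`). -/

/-! ### Injective parametrization of Polish spaces up to countable sets -/

/-- An uncountable subset of a second countable space has a condensation point. -/
lemma exists_condensation_point {Z : Type*} [TopologicalSpace Z] [SecondCountableTopology Z]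
    {A : Set Z} (hA : ¬ A.Countable) : ∃ p ∈ A, ∀ U ∈ 𝓝 p, ¬ (A ∩ U).Countable := by
  by_contra! h
  choose! U hU hc using h
  obtain ⟨t, htA, htc, hcov⟩ := TopologicalSpace.countable_cover_nhdsWithin
    (f := U) (s := A) fun x hx => mem_nhdsWithin_of_mem_nhds (hU x hx)
  refine hA ((htc.biUnion fun x hx => hc x (htA hx)).mono fun y hy => ?_)
  obtain ⟨x, hx, hyx⟩ := mem_iUnion₂.1 (hcov hy)
  exact mem_iUnion₂.2 ⟨x, hx, hy, hyx⟩

/-- An uncountable locally closed set splits, up to a countable set, into infinitely many small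
uncountable locally closed pieces. -/
lemma exists_locallyClosed_split {Z : Type*} [MetricSpace Z] [SecondCountableTopology Z]
    {A : Set Z} (hA : IsLocallyClosed A) (hu : ¬ A.Countable) {ε : ℝ} (hε : 0 < ε) :
    ∃ D : ℕ → Set Z, (∀ n, IsLocallyClosed (D n) ∧ ¬ (D n).Countable ∧ closure (D n) ⊆ A ∧
      Metric.ediam (D n) ≤ ENNReal.ofReal ε) ∧ Pairwise (Function.onFun Disjoint D) ∧
      (A \ ⋃ n, D n).Countable := by
  obtain ⟨p, hpA, hp⟩ := exists_condensation_point hu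
  obtain ⟨U, F, hU, hF, rfl⟩ := hA
  have hU' : IsOpen (U \ {p}) := hU.sdiff isClosed_singleton
  have hr : ∀ x ∈ U \ {p}, ∃ r > 0, r ≤ ε / 2 ∧ Metric.closedBall x r ⊆ U \ {p} := by
    intro x hx
    obtain ⟨r, hr, hs⟩ := Metric.nhds_basis_closedBall.mem_iff.1 (hU'.mem_nhds hx)
    exact ⟨min r (ε / 2), by positivity, min_le_right _ _,
      (Metric.closedBall_subset_closedBall (min_le_left _ _)).trans hs⟩
  choose! r hr0 hrε hrU using hr
  obtain ⟨t, htU, htc, hcov⟩ := TopologicalSpace.countable_cover_nhdsWithin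
    (f := fun x => Metric.ball x (r x)) (s := U \ {p})
    fun x hx => mem_nhdsWithin_of_mem_nhds (Metric.ball_mem_nhds x (hr0 x hx))
  have htne : t.Nonempty := by
    by_contra hne
    rw [not_nonempty_iff_eq_empty] at hne
    subst hne
    refine hu ((countable_singleton p).mono fun x hx => ?_)
    by_contra hxp
    simpa using hcov ⟨hx.1, hxp⟩
  obtain ⟨u, rfl⟩ := htc.exists_eq_range htne
  set B : ℕ → Set Z := fun n => Metric.ball (u n) (r (u n)) with hB
  set E : ℕ → Set Z := fun n => disjointed B n ∩ F with hE
  have hEB : ∀ n, E n ⊆ Metric.closedBall (u n) (r (u n)) := fun n =>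
    inter_subset_left.trans ((disjointed_subset B n).trans Metric.ball_subset_closedBall)
  have hEcl : ∀ n, closure (E n) ⊆ (U \ {p}) ∩ F := fun n => subset_inter
    ((closure_minimal (hEB n) Metric.isClosed_closedBall).trans (hrU _ (htU ⟨n, rfl⟩)))
    (closure_minimal inter_subset_right hF)
  have hElc : ∀ n, IsLocallyClosed (E n) := by
    intro n
    have : E n = B n ∩ ((⋃ j < n, B j)ᶜ ∩ F) := by
      simp only [hE, disjointed_eq_inter_compl, compl_iUnion, inter_assoc]
    rw [this]
    exact ⟨_, _, Metric.isOpen_ball, ((isOpen_biUnion fun _ _ => Metric.isOpen_ball).isClosed_compl.inter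
      hF), rfl⟩
  have hEd : Pairwise (Function.onFun Disjoint E) := fun i j hij =>
    (disjoint_disjointed B hij).mono inter_subset_left inter_subset_left
  have hEU : (U \ {p}) ∩ F ⊆ ⋃ n, E n := by
    rintro x ⟨hxU, hxF⟩
    have hx : x ∈ ⋃ n, disjointed B n := by
      rw [iUnion_disjointed]
      simpa [hB] using hcov hxU
    obtain ⟨n, hn⟩ := mem_iUnion.1 hx
    exact mem_iUnion.2 ⟨n, hn, hxF⟩
  set N : Set ℕ := {n | ¬ (E n).Countable} with hN
  -- The closures of the pieces avoid `p`. Were only finitely many uncountable, some neighborhood of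
  -- `p` would meet the set in countably many points.
  have hNinf : N.Infinite := by
    intro hfin
    have hcl : IsClosed (⋃ n ∈ N, closure (E n)) := hfin.isClosed_biUnion fun _ _ => isClosed_closure
    have hpn : p ∉ ⋃ n ∈ N, closure (E n) := by
      intro h
      obtain ⟨n, -, hn⟩ := mem_iUnion₂.1 h
      exact (hEcl n hn).1.2 rfl
    refine hp _ (hcl.isOpen_compl.mem_nhds hpn) ?_
    have hc : ({p} ∪ ⋃ n ∈ Nᶜ, E n).Countable := (countable_singleton p).union
      ((to_countable _).biUnion fun n hn => not_not.1 hn)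
    refine hc.mono ?_
    rintro x ⟨⟨hxU, hxF⟩, hx⟩
    by_cases hxp : x = p
    · exact Or.inl hxp
    obtain ⟨n, hn⟩ := mem_iUnion.1 (hEU ⟨⟨hxU, hxp⟩, hxF⟩)
    refine Or.inr (mem_iUnion₂.2 ⟨n, fun hnN => hx ?_, hn⟩)
    exact mem_iUnion₂.2 ⟨n, hnN, subset_closure hn⟩
  have := hNinf.to_subtype
  obtain ⟨_⟩ := nonempty_denumerable N
  let e : ℕ ≃ N := (Denumerable.eqv N).symm
  refine ⟨fun n => E (e n), fun n => ⟨hElc _, (e n).2, (hEcl _).trans ?_, ?_⟩, ?_, ?_⟩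
  · exact inter_subset_inter_left _ sdiff_subset
  · have hx := htU ⟨(e n : ℕ), rfl⟩
    refine Metric.ediam_le fun y hy z hz => ?_
    rw [edist_dist]
    refine ENNReal.ofReal_le_ofReal ((dist_triangle_right y z (u (e n))).trans ?_)
    linarith [hrε _ hx, Metric.mem_closedBall.1 (hEB _ hy), Metric.mem_closedBall.1 (hEB _ hz)]
  · intro i j hij
    exact hEd fun h => hij (e.injective (Subtype.ext h))
  · have hc : ({p} ∪ ⋃ n ∈ Nᶜ, E n).Countable := (countable_singleton p).union
      ((to_countable _).biUnion fun n hn => not_not.1 hn)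
    refine hc.mono ?_
    rintro x ⟨⟨hxU, hxF⟩, hx⟩
    by_cases hxp : x = p
    · exact Or.inl hxp
    obtain ⟨n, hn⟩ := mem_iUnion.1 (hEU ⟨⟨hxU, hxp⟩, hxF⟩)
    refine Or.inr (mem_iUnion₂.2 ⟨n, fun hnN => hx ?_, hn⟩)
    exact mem_iUnion.2 ⟨e.symm ⟨n, hnN⟩, by simpa using hn⟩

open CantorScheme PiNat in
/-- An uncountable Polish space is, up to a countable set, a continuous injective image of the Baire
space. -/
lemma exists_continuous_injective_of_polish (Z : Type*) [TopologicalSpace Z] [PolishSpace Z]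
    (hZ : ¬ Countable Z) :
    ∃ f : (ℕ → ℕ) → Z, Continuous f ∧ Function.Injective f ∧ (range f)ᶜ.Countable := by
  let := TopologicalSpace.upgradeIsCompletelyMetrizable Z
  have hε : ∀ n : ℕ, (0 : ℝ) < (1 / 2) ^ n := fun n => by positivity
  choose! D hD hdisj hcount using fun (n : ℕ) (A : Set Z)
    (h : IsLocallyClosed A ∧ ¬ A.Countable) => exists_locallyClosed_split h.1 h.2 (hε n)
  let A : List ℕ → Set Z := fun l => l.rec univ fun n l' ih => D l'.length ih n
  have hcons : ∀ n l, A (n :: l) = D l.length (A l) n := fun _ _ => rfl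
  have hA : ∀ l, IsLocallyClosed (A l) ∧ ¬ (A l).Countable := by
    intro l
    induction l with
    | nil => exact ⟨isClosed_univ.isLocallyClosed, by rwa [show A [] = univ from rfl, countable_univ_iff]⟩
    | cons n l ih =>
      rw [hcons]
      exact ⟨(hD _ _ ih n).1, (hD _ _ ih n).2.1⟩
  have hanti : ClosureAntitone A := fun l n => by rw [hcons]; exact (hD _ _ (hA l) n).2.2.1
  have hdis : CantorScheme.Disjoint A := fun l i j hij => by
    simp only [hcons]
    exact hdisj _ _ (hA l) hij
  have hdiam : VanishingDiam A := by
    intro x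
    have ht : Tendsto (fun n : ℕ => ENNReal.ofReal ((1 / 2) ^ n)) atTop (𝓝 0) := by
      rw [← ENNReal.ofReal_zero]
      exact ENNReal.tendsto_ofReal
        (tendsto_pow_atTop_nhds_zero_of_lt_one (by norm_num) (by norm_num))
    rw [← tendsto_add_atTop_iff_nat 1]
    refine tendsto_of_tendsto_of_tendsto_of_le_of_le tendsto_const_nhds ht (fun _ => zero_le) ?_
    intro n
    have := (hD n _ (hA (res x n)) (x n)).2.2.2
    simpa [res_succ, hcons] using this
  have huniv : (inducedMap A).1 = univ := hanti.map_of_vanishingDiam hdiam fun l =>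
    nonempty_iff_ne_empty.2 fun h => (hA l).2 (h ▸ countable_empty)
  let j : (ℕ → ℕ) → (inducedMap A).1 := fun x => ⟨x, huniv ▸ mem_univ x⟩
  have hj : Continuous j := by fun_prop
  refine ⟨fun x => (inducedMap A).2 (j x), hdiam.map_continuous.comp hj,
    hdis.map_injective.comp fun x y h => congrArg Subtype.val h, ?_⟩
  -- A point lost at no node follows an infinite branch, so vanishing diameter puts it in the range.
  have hc : (⋃ l, A l \ ⋃ n, A (n :: l)).Countable :=
    countable_iUnion fun l => hcount _ _ (hA l)
  refine hc.mono fun y hy => ?_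
  by_contra hyc
  have hstep : ∀ l, y ∈ A l → ∃ n, y ∈ A (n :: l) := by
    intro l hl
    by_contra hn
    exact hyc (mem_iUnion.2 ⟨l, hl, fun h => hn (mem_iUnion.1 h)⟩)
  choose! c hcA using hstep
  let L : ℕ → List ℕ := fun n => n.rec [] fun _ l => c l :: l
  let x : ℕ → ℕ := fun n => c (L n)
  have hL : ∀ n, res x n = L n := by
    intro n
    induction n with
    | zero => rfl
    | succ n ih => rw [res_succ, ih]
  have hyL : ∀ n, y ∈ A (L n) := by
    intro n
    induction n with
    | zero => exact mem_univ y
    | succ n ih => exact hcA _ ih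
  refine hy ⟨x, ?_⟩
  refine eq_of_forall_dist_le fun ε hε => ?_
  obtain ⟨n, hn⟩ := hdiam.dist_lt ε hε x
  exact (hn _ (map_mem (j x) n) y (hL n ▸ hyL n)).le

/-! ### Uncountable Borel sets and disjoint refinements -/

/-- In a standard Borel space with a compatible second countable topology, an uncountable measurable
set is, up to a countable set, a continuous injective image of the Baire space. -/
lemma MeasurableSet.exists_continuous_injective {S : Type*} [MeasurableSpace S]
    [StandardBorelSpace S] [TopologicalSpace S] [SecondCountableTopology S] [OpensMeasurableSpace S]
    {B : Set S} (hB : MeasurableSet B) (hu : ¬ B.Countable) :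
    ∃ f : (ℕ → ℕ) → S, Continuous f ∧ Function.Injective f ∧ range f ⊆ B ∧
      (B \ range f).Countable := by
  have hsb : StandardBorelSpace B := hB.standardBorel
  -- The topology of `S` need not be Polish, so `B` receives a Polish topology for which the
  -- inclusion into `S` is continuous.
  have key : ∃ t : TopologicalSpace B, @PolishSpace B t ∧
      @Continuous B S t _ Subtype.val := by
    obtain ⟨τ, hτ, hP⟩ := hsb.polish
    obtain ⟨t', -, hc, hP'⟩ := @Measurable.exists_continuous B S τ hP _ hτ _ _ _ Subtype.val _
      measurable_subtype_coe
    exact ⟨t', hP', hc⟩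
  obtain ⟨t, hP, hc⟩ := key
  obtain ⟨f, hf, hinj, hco⟩ := @exists_continuous_injective_of_polish B t hP
    (by rwa [countable_coe_iff])
  refine ⟨fun x => f x, hc.comp hf, Subtype.val_injective.comp hinj, ?_, ?_⟩
  · rintro _ ⟨x, rfl⟩
    exact (f x).2
  · refine (hco.image Subtype.val).mono ?_
    rintro x ⟨hx, hxf⟩
    exact ⟨⟨x, hx⟩, fun ⟨z, hz⟩ => hxf ⟨z, by simp [hz]⟩, rfl⟩

/-- An uncountable measurable subset of a standard Borel space contains a family of pairwise
disjoint uncountable measurable sets indexed by the reals. -/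
lemma MeasurableSet.exists_disjoint_real_family {S : Type*} [MeasurableSpace S]
    [StandardBorelSpace S] {B : Set S} (hB : MeasurableSet B) (hu : ¬ B.Countable) :
    ∃ K : ℝ → Set S, (∀ a, K a ⊆ B ∧ MeasurableSet (K a) ∧ ¬ (K a).Countable) ∧
      ∀ a b, a ≠ b → Disjoint (K a) (K b) := by
  have hsb : StandardBorelSpace B := hB.standardBorel
  have hR : ¬ (univ : Set ℝ).Countable := Cardinal.not_countable_real
  have hRR : ¬ Countable (ℝ × ℝ) := fun h => hR
    (countable_univ_iff.2 (Function.Injective.countable (f := fun x : ℝ => (x, x))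
      fun _ _ h => congrArg Prod.fst h))
  let e : B ≃ᵐ ℝ × ℝ := PolishSpace.measurableEquivOfNotCountable (by rwa [countable_coe_iff]) hRR
  refine ⟨fun a => Subtype.val '' (e ⁻¹' (Prod.fst ⁻¹' {a})), fun a => ⟨?_, ?_, ?_⟩, ?_⟩
  · exact Subtype.coe_image_subset _ _
  · exact hB.subtype_image (e.measurable (measurable_fst (measurableSet_singleton a)))
  · intro h
    refine hR (((h.preimage (f := fun y : ℝ => ((e.symm (a, y) : B) : S)) ?_)).mono ?_)
    · intro x y hxy
      simpa using e.symm.injective (Subtype.ext hxy)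
    · intro y _
      exact ⟨e.symm (a, y), by simp, rfl⟩
  · intro a b hab
    rw [disjoint_left]
    rintro _ ⟨x, hx, rfl⟩ ⟨y, hy, hxy⟩
    rw [Subtype.ext hxy] at hy
    exact hab (hx.symm.trans hy)

/-- Countably many uncountable measurable sets have a disjoint refinement by uncountable measurable
sets. -/
lemma exists_disjoint_measurable_refinement {S : Type*} [MeasurableSpace S]
    [StandardBorelSpace S] {V : ℕ → Set S} (hV : ∀ i, MeasurableSet (V i))
    (hu : ∀ i, ¬ (V i).Countable) :
    ∃ R : ℕ → Set S, (∀ i, R i ⊆ V i ∧ MeasurableSet (R i) ∧ ¬ (R i).Countable) ∧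
      Pairwise (Function.onFun Disjoint R) := by
  have step : ∀ (Q : Set S) (k : ℕ), (MeasurableSet Q ∧ ∀ i, ¬ (Q ∩ V i).Countable) →
      ∃ R, R ⊆ Q ∩ V k ∧ MeasurableSet R ∧ ¬ R.Countable ∧ ∀ i, ¬ ((Q \ R) ∩ V i).Countable := by
    rintro Q k ⟨hQ, hQu⟩
    obtain ⟨K, hK, hKd⟩ := (hQ.inter (hV k)).exists_disjoint_real_family (hQu k)
    -- Each `i` excludes at most one real: for `a ≠ b`, disjointness makes `Q \ K a` and `Q \ K b`
    -- cover `Q`.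
    have hbad : (⋃ i, {a | ((Q \ K a) ∩ V i).Countable}).Countable := by
      refine countable_iUnion fun i => Set.Subsingleton.countable ?_
      intro a ha b hb
      by_contra hab
      refine hQu i ((ha.union hb).mono ?_)
      rintro x ⟨hxQ, hxV⟩
      by_cases hx : x ∈ K a
      · exact Or.inr ⟨⟨hxQ, disjoint_left.1 (hKd a b hab) hx⟩, hxV⟩
      · exact Or.inl ⟨⟨hxQ, hx⟩, hxV⟩
    obtain ⟨a, ha⟩ : ∃ a, a ∉ ⋃ i, {a | ((Q \ K a) ∩ V i).Countable} := by
      by_contra! h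
      exact Cardinal.not_countable_real (hbad.mono fun a _ => h a)
    refine ⟨K a, (hK a).1, (hK a).2.1, (hK a).2.2, fun i hi => ha (mem_iUnion.2 ⟨i, hi⟩)⟩
  choose! R hR hRm hRu hRn using step
  let Q : ℕ → Set S := fun n => n.rec univ fun k Q => Q \ R Q k
  have hQ : ∀ n, MeasurableSet (Q n) ∧ ∀ i, ¬ (Q n ∩ V i).Countable := by
    intro n
    induction n with
    | zero => exact ⟨MeasurableSet.univ, fun i => by simpa [Q] using hu i⟩
    | succ n ih => exact ⟨ih.1.diff (hRm _ _ ih), hRn _ _ ih⟩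
  have hQanti : Antitone Q := antitone_nat_of_succ_le fun n => sdiff_subset
  refine ⟨fun n => R (Q n) n, fun n => ⟨(hR _ _ (hQ n)).trans inter_subset_right, hRm _ _ (hQ n),
    hRu _ _ (hQ n)⟩, ?_⟩
  have hlt : ∀ i j, i < j → Disjoint (R (Q i) i) (R (Q j) j) := by
    intro i j hij
    rw [disjoint_right]
    intro x hx
    have hx' : x ∈ Q (i + 1) := hQanti hij ((hR _ _ (hQ j)) hx).1
    exact hx'.2
  intro i j hij
  rcases hij.lt_or_gt with h | h
  · exact hlt i j h
  · exact (hlt j i h).symm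

/-! ### Gluing injective images of the Baire space -/

/-- A set is a Baire image if it is the range of a continuous injection of the Baire space. -/
def IsBaireImage {S : Type*} [TopologicalSpace S] (A : Set S) : Prop :=
  ∃ f : (ℕ → ℕ) → S, Continuous f ∧ Function.Injective f ∧ range f = A

/-- Sequences with a prescribed first term. -/
def consSeq (k : ℕ) (x : ℕ → ℕ) : ℕ → ℕ := fun n => n.casesOn k x

lemma continuous_consSeq (k : ℕ) : Continuous (consSeq k) :=
  continuous_pi fun n => by
    cases n with
    | zero => exact continuous_const
    | succ n => exact continuous_apply n

lemma consSeq_zero_shift (x : ℕ → ℕ) : consSeq (x 0) (fun n => x (n + 1)) = x := by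
  funext n
  cases n <;> rfl

lemma consSeq_inj {k k' : ℕ} {x x' : ℕ → ℕ} (h : consSeq k x = consSeq k' x') :
    k = k' ∧ x = x' :=
  ⟨congrFun h 0, funext fun n => congrFun h (n + 1)⟩

/-- A countable disjoint union of Baire images is a Baire image. -/
lemma IsBaireImage.iUnion {S I : Type*} [TopologicalSpace S] [Countable I] [Nonempty I]
    {A : I → Set S} (hA : ∀ i, IsBaireImage (A i)) (hd : Pairwise (Function.onFun Disjoint A)) :
    IsBaireImage (⋃ i, A i) := by
  choose f hf hinj hr using hA
  have hfA : ∀ i x, f i x ∈ A i := fun i x => hr i ▸ mem_range_self x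
  obtain ⟨_⟩ := nonempty_denumerable (I × ℕ)
  let e : ℕ ≃ I × ℕ := (Denumerable.eqv (I × ℕ)).symm
  have htail : Continuous fun (x : ℕ → ℕ) (n : ℕ) => x (n + 1) := by fun_prop
  refine ⟨fun x => f (e (x 0)).1 (consSeq (e (x 0)).2 fun n => x (n + 1)), ?_, ?_, ?_⟩
  · refine continuous_iff_continuousAt.2 fun x => ?_
    have h0 : ∀ᶠ y in 𝓝 x, y 0 = x 0 :=
      (continuous_apply 0).continuousAt.eventually_mem ((isOpen_discrete {x 0}).mem_nhds rfl)
    refine ((hf (e (x 0)).1).comp ((continuous_consSeq (e (x 0)).2).comp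
      htail)).continuousAt.congr ?_
    filter_upwards [h0] with y hy
    simp only [Function.comp, hy]
  · intro x y hxy
    have hi : (e (x 0)).1 = (e (y 0)).1 := by
      by_contra hne
      refine disjoint_left.1 (hd hne) (hfA _ (consSeq (e (x 0)).2 fun n => x (n + 1))) ?_
      dsimp only at hxy
      rw [hxy]
      exact hfA _ _
    simp only [hi] at hxy
    obtain ⟨h1, h2⟩ := consSeq_inj (hinj _ hxy)
    have h0 : x 0 = y 0 := e.injective (Prod.ext hi h1)
    rw [← consSeq_zero_shift x, ← consSeq_zero_shift y, h0, h2]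
  · ext s
    simp only [mem_range, mem_iUnion]
    constructor
    · rintro ⟨x, rfl⟩
      exact ⟨_, hr _ ▸ mem_range_self _⟩
    · rintro ⟨i, hs⟩
      rw [← hr i] at hs
      obtain ⟨z, rfl⟩ := hs
      refine ⟨consSeq (e.symm (i, z 0)) fun n => z (n + 1), ?_⟩
      change f (e (e.symm (i, z 0))).1 (consSeq (e (e.symm (i, z 0))).2 fun n => z (n + 1)) = f i z
      rw [Equiv.apply_symm_apply]
      exact congrArg (f i) (consSeq_zero_shift z)

/-- Adding a limit point to a disjoint sequence of Baire images converging to it gives a Baire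
image. -/
lemma IsBaireImage.insert_iUnion {S : Type*} [TopologicalSpace S] {A : ℕ → Set S} {p : S}
    (hA : ∀ k, IsBaireImage (A k)) (hd : Pairwise (Function.onFun Disjoint A))
    (hp : ∀ k, p ∉ A k) (hlim : ∀ O ∈ 𝓝 p, ∀ᶠ k in atTop, A k ⊆ O) :
    IsBaireImage (insert p (⋃ k, A k)) := by
  classical
  choose f hf hinj hr using hA
  -- The zero sequence codes `p`; the position `k` of the first nonzero term selects `A k`. That
  -- term is at least 1, so subtracting 1 recovers an arbitrary first coordinate. Sequences near
  -- zero select only large `k`, which gives continuity there.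
  let g : ℕ → (ℕ → ℕ) → S := fun k x => f k (consSeq (x k - 1) fun n => x (k + (n + 1)))
  let F : (ℕ → ℕ) → S := fun x => if h : ∃ k, x k ≠ 0 then g (Nat.find h) x else p
  have hF0 : F 0 = p := dif_neg (by simp)
  have hFk : ∀ (x : ℕ → ℕ) (k : ℕ), x k ≠ 0 → (∀ j < k, x j = 0) → F x = g k x := by
    intro x k hk hj
    have h : ∃ k, x k ≠ 0 := ⟨k, hk⟩
    have : Nat.find h = k := (Nat.find_eq_iff h).2 ⟨hk, fun j hjk => not_not.2 (hj j hjk)⟩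
    simp only [F, dif_pos h, this]
  have hcase : ∀ x : ℕ → ℕ, x = 0 ∨ ∃ k, x k ≠ 0 ∧ ∀ j < k, x j = 0 := by
    intro x
    by_cases h : ∃ k, x k ≠ 0
    · exact Or.inr ⟨Nat.find h, Nat.find_spec h, fun j hj => not_not.1 (Nat.find_min h hj)⟩
    · push Not at h
      exact Or.inl (funext h)
  have hgA : ∀ k x, g k x ∈ A k := fun k x => hr k ▸ mem_range_self _
  have hgc : ∀ k, Continuous (g k) := by
    intro k
    refine (hf k).comp (continuous_pi fun n => ?_)
    cases n with
    | zero =>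
      exact Continuous.comp (g := fun m : ℕ => m - 1) continuous_of_discreteTopology
        (continuous_apply k)
    | succ n => exact continuous_apply (k + (n + 1))
  have hev : ∀ (x : ℕ → ℕ) (j : ℕ), ∀ᶠ y in 𝓝 x, y j = x j := fun x j =>
    (continuous_apply j).continuousAt.eventually_mem ((isOpen_discrete {x j}).mem_nhds rfl)
  refine ⟨F, continuous_iff_continuousAt.2 fun x => ?_, ?_, ?_⟩
  · rcases hcase x with rfl | ⟨k, hk, hj⟩
    · refine tendsto_def.2 fun O hO => ?_
      rw [hF0] at hO
      obtain ⟨N, hN⟩ := eventually_atTop.1 (hlim O hO)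
      have h0 : ∀ᶠ y in 𝓝 (0 : ℕ → ℕ), ∀ j ∈ Finset.range N, y j = 0 :=
        (Finset.eventually_all _).2 fun j _ => hev 0 j
      filter_upwards [h0] with y hy
      rcases hcase y with rfl | ⟨k, hk, hj⟩
      · rw [mem_preimage, hF0]
        exact mem_of_mem_nhds hO
      · rw [mem_preimage, hFk y k hk hj]
        refine hN k ?_ (hgA k y)
        by_contra! hlt
        exact hk (hy k (Finset.mem_range.2 hlt))
    · refine (hgc k).continuousAt.congr ?_
      have h0 : ∀ᶠ y in 𝓝 x, ∀ j ∈ Finset.range (k + 1), y j = x j :=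
        (Finset.eventually_all _).2 fun j _ => hev x j
      filter_upwards [h0] with y hy
      refine (hFk y k ?_ fun j hjk => ?_).symm
      · rwa [hy k (by simp)]
      · rw [hy j (by simp; lia), hj j hjk]
  · have hne : ∀ x k, p ≠ g k x := fun x k h => hp k (h ▸ hgA k x)
    intro x y hxy
    rcases hcase x with rfl | ⟨k, hk, hj⟩ <;> rcases hcase y with rfl | ⟨k', hk', hj'⟩
    · rfl
    · rw [hF0, hFk y k' hk' hj'] at hxy
      exact absurd hxy (hne _ _)
    · rw [hF0, hFk x k hk hj] at hxy
      exact absurd hxy.symm (hne _ _)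
    · rw [hFk x k hk hj, hFk y k' hk' hj'] at hxy
      obtain rfl : k = k' := by
        by_contra hkk
        exact disjoint_left.1 (hd hkk) (hgA k x) (hxy ▸ hgA k' y)
      obtain ⟨h1, h2⟩ := consSeq_inj (hinj k hxy)
      funext n
      rcases lt_trichotomy n k with h | rfl | h
      · rw [hj n h, hj' n h]
      · lia
      · obtain ⟨m, rfl⟩ := Nat.exists_eq_add_of_lt h
        exact congrFun h2 m
  · ext s
    constructor
    · rintro ⟨x, rfl⟩
      rcases hcase x with rfl | ⟨k, hk, hj⟩
      · exact Or.inl hF0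
      · exact Or.inr (mem_iUnion.2 ⟨k, hFk x k hk hj ▸ hgA k x⟩)
    · rintro (rfl | hs)
      · exact ⟨0, hF0⟩
      · obtain ⟨k, hk⟩ := mem_iUnion.1 hs
        rw [← hr k] at hk
        obtain ⟨z, rfl⟩ := hk
        refine ⟨fun n => if n < k then 0 else consSeq (z 0 + 1) (fun m => z (m + 1)) (n - k), ?_⟩
        rw [hFk _ k (by simp [consSeq]) fun j hj => by simp [hj]]
        refine congrArg (f k) ?_
        funext n
        cases n with
        | zero => simp [consSeq]
        | succ n => simp [consSeq]

/-- A standard Borel space with a compatible second countable topology all of whose nonempty open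
sets are uncountable is a continuous bijective image of the Baire space. -/
theorem exists_continuous_bijective_of_open_uncountable {S : Type*} [MeasurableSpace S]
    [StandardBorelSpace S] [TopologicalSpace S] [SecondCountableTopology S] [OpensMeasurableSpace S]
    [Nonempty S] (hS : ∀ O : Set S, IsOpen O → O.Nonempty → ¬ O.Countable) :
    ∃ f : (ℕ → ℕ) → S, Continuous f ∧ Function.Bijective f := by
  obtain ⟨b, hbc, hbe, hb⟩ := TopologicalSpace.exists_countable_basis S
  have hbne : b.Nonempty := by
    obtain ⟨s⟩ := ‹Nonempty S›
    obtain ⟨v, hv, -⟩ := hb.exists_subset_of_mem_open (mem_univ s) isOpen_univ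
    exact ⟨v, hv⟩
  obtain ⟨β, rfl⟩ := hbc.exists_eq_range hbne
  have hβo : ∀ i, IsOpen (β i) := fun i => hb.isOpen ⟨i, rfl⟩
  have hβu : ∀ i, ¬ (β i).Countable := fun i =>
    hS _ (hβo i) (nonempty_iff_ne_empty.2 fun h => hbe ⟨i, h⟩)
  -- A triple records a basic open set, the code of an exceptional point and a position in the
  -- sequence for that point. The index `none` will take all that the triples leave over.
  let e : ℕ ≃ Option (ℕ × ℕ × ℕ) := (Denumerable.eqv _).symm
  let V : Option (ℕ × ℕ × ℕ) → Set S := fun j => j.elim univ fun q => β q.1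
  have hVm : ∀ j, MeasurableSet (V j) := by
    rintro (_ | q)
    · exact MeasurableSet.univ
    · exact (hβo q.1).measurableSet
  have hVu : ∀ j, ¬ (V j).Countable := by
    rintro (_ | q)
    · exact hS _ isOpen_univ univ_nonempty
    · exact hβu q.1
  obtain ⟨R, hR, hRd⟩ := exists_disjoint_measurable_refinement (V := fun n => V (e n))
    (fun n => hVm _) (fun n => hVu _)
  let T : Option (ℕ × ℕ × ℕ) → Set S := fun j =>
    j.elim (⋃ q, R (e.symm (some q)))ᶜ fun q => R (e.symm (some q))
  have hTm : ∀ j, MeasurableSet (T j) := by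
    rintro (_ | q)
    · exact (MeasurableSet.iUnion fun q => (hR _).2.1).compl
    · exact (hR _).2.1
  have hTu : ∀ j, ¬ (T j).Countable := by
    rintro (_ | q)
    · refine fun h => (hR (e.symm none)).2.2 (h.mono ?_)
      exact subset_compl_iff_disjoint_right.2 (disjoint_iUnion_right.2 fun q =>
        hRd (e.symm.injective.ne (by simp)))
    · exact (hR _).2.2
  have hTd : Pairwise (Function.onFun Disjoint T) := by
    rintro (_ | q) (_ | q') hne
    · exact absurd rfl hne
    · exact disjoint_compl_left_iff_subset.2 (subset_iUnion (fun q => R (e.symm (some q))) q')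
    · exact disjoint_compl_right_iff_subset.2 (subset_iUnion (fun q => R (e.symm (some q))) q)
    · exact hRd (e.symm.injective.ne hne)
  have hTV : ∀ q : ℕ × ℕ × ℕ, T (some q) ⊆ β q.1 := fun q => by
    have := (hR (e.symm (some q))).1
    rwa [Equiv.apply_symm_apply] at this
  have hTcov : ∀ s, ∃ j, s ∈ T j := by
    intro s
    by_cases h : s ∈ ⋃ q, R (e.symm (some q))
    · obtain ⟨q, hq⟩ := mem_iUnion.1 h
      exact ⟨some q, hq⟩
    · exact ⟨none, h⟩
  choose f hf hinj hfT hfc using fun j => (hTm j).exists_continuous_injective (hTu j)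
  let P : Option (ℕ × ℕ × ℕ) → Set S := fun j => range (f j)
  have hP : ∀ j, IsBaireImage (P j) := fun j => ⟨f j, hf j, hinj j, rfl⟩
  have hPd : Pairwise (Function.onFun Disjoint P) := fun i j hij =>
    (hTd hij).mono (hfT i) (hfT j)
  let C : Set S := (⋃ j, P j)ᶜ
  have hC : C.Countable := by
    refine (countable_iUnion hfc).mono fun s hs => ?_
    obtain ⟨j, hj⟩ := hTcov s
    exact mem_iUnion.2 ⟨j, hj, fun h => hs (mem_iUnion.2 ⟨j, h⟩)⟩
  have hCP : ∀ c ∈ C, ∀ j, c ∉ P j := fun c hc j h => hc (mem_iUnion.2 ⟨j, h⟩)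
  have := hC.to_subtype
  obtain ⟨code, hcode⟩ := exists_injective_nat C
  have hnear : ∀ c : C, ∃ i : ℕ → ℕ, ∀ O ∈ 𝓝 (c : S), ∀ᶠ k in atTop, β (i k) ⊆ O := by
    intro c
    obtain ⟨O, hO⟩ := (𝓝 (c : S)).exists_antitone_basis
    have hi : ∀ k, ∃ i, β i ⊆ O k := by
      intro k
      obtain ⟨_, ⟨i, rfl⟩, -, hi⟩ := hb.mem_nhds_iff.1 (hO.mem k)
      exact ⟨i, hi⟩
    choose i hi using hi
    refine ⟨i, fun U hU => ?_⟩
    obtain ⟨k, hk⟩ := hO.mem_iff.1 hU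
    filter_upwards [eventually_ge_atTop k] with l hl
    exact (hi l).trans ((hO.antitone hl).trans hk)
  choose i hi using hnear
  let q : C → ℕ → Option (ℕ × ℕ × ℕ) := fun c k => some (i c k, code c, k)
  have hq : ∀ c c' k k', q c k = q c' k' → c = c' ∧ k = k' := by
    intro c c' k k' h
    simp only [q, Option.some.injEq, Prod.mk.injEq] at h
    exact ⟨hcode h.2.1, h.2.2⟩
  -- Each exceptional point is joined to its own sequence of pieces; the last two entries of `q c k`
  -- prevent any reuse, even if basic sets repeat.
  let A : C ⊕ {j // ∀ c k, j ≠ q c k} → Set S :=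
    Sum.elim (fun c => insert (c : S) (⋃ k, P (q c k))) fun j => P j
  have hA : ∀ a, IsBaireImage (A a) := by
    rintro (c | j)
    · refine IsBaireImage.insert_iUnion (fun k => hP _)
        (fun k k' hkk => hPd fun h => hkk (hq _ _ _ _ h).2) (fun k => hCP _ c.2 _) ?_
      intro O hO
      filter_upwards [hi c O hO] with k hk
      exact (hfT _).trans ((hTV _).trans hk)
    · exact hP j
  have hAd : Pairwise (Function.onFun Disjoint A) := by
    have hne : ∀ s a a', s ∈ A a → s ∈ A a' → a = a' := by
      have hPi : ∀ s j j', s ∈ P j → s ∈ P j' → j = j' := by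
        intro s j j' h h'
        by_contra hjj
        exact disjoint_left.1 (hPd hjj) h h'
      rintro s (c | j) (c' | j') h h'
      · rcases h with rfl | h <;> rcases h' with h' | h'
        · rw [Subtype.ext h']
        · obtain ⟨k, hk⟩ := mem_iUnion.1 h'
          exact absurd hk (hCP _ c.2 _)
        · obtain ⟨k, hk⟩ := mem_iUnion.1 h
          exact absurd (h' ▸ hk) (hCP _ c'.2 _)
        · obtain ⟨k, hk⟩ := mem_iUnion.1 h
          obtain ⟨k', hk'⟩ := mem_iUnion.1 h'
          rw [(hq _ _ _ _ (hPi _ _ _ hk hk')).1]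
      · rcases h with rfl | h
        · exact absurd h' (hCP _ c.2 _)
        · obtain ⟨k, hk⟩ := mem_iUnion.1 h
          exact absurd (hPi _ _ _ h' hk) (j'.2 c k)
      · rcases h' with rfl | h'
        · exact absurd h (hCP _ c'.2 _)
        · obtain ⟨k, hk⟩ := mem_iUnion.1 h'
          exact absurd (hPi _ _ _ h hk) (j.2 c' k)
      · rw [Subtype.ext (hPi _ _ _ h h')]
    intro a a' haa
    exact disjoint_left.2 fun s h h' => haa (hne s a a' h h')
  have hcov : ⋃ a, A a = univ := by
    refine eq_univ_of_forall fun s => mem_iUnion.2 ?_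
    by_cases hs : s ∈ C
    · exact ⟨Sum.inl ⟨s, hs⟩, Or.inl rfl⟩
    obtain ⟨j, hj⟩ := mem_iUnion.1 (not_not.1 hs)
    by_cases hu : ∀ c k, j ≠ q c k
    · exact ⟨Sum.inr ⟨j, hu⟩, hj⟩
    · push Not at hu
      obtain ⟨c, k, rfl⟩ := hu
      exact ⟨Sum.inl c, Or.inr (mem_iUnion.2 ⟨k, hj⟩)⟩
  have : Nonempty (C ⊕ {j // ∀ c k, j ≠ q c k}) := ⟨Sum.inr ⟨none, by simp [q]⟩⟩
  obtain ⟨F, hF, hFi, hFr⟩ := IsBaireImage.iUnion hA hAd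
  exact ⟨F, hF, hFi, range_eq_univ.1 (hFr.trans hcov)⟩

/-! ### Open sets in noncompact spaces -/

lemma nonempty_of_noncompact (Y : Type*) [TopologicalSpace Y] [NoncompactSpace Y] : Nonempty Y := by
  by_contra h
  rw [not_nonempty_iff] at h
  exact noncompact_univ Y (toFinite univ).isCompact

/-- The σ-algebra on `Prop` is discrete although its topology is Sierpiński, so `ℕ → Prop` is
standard Borel without being Hausdorff. -/
instance Prop.opensMeasurableSpace : OpensMeasurableSpace Prop := ⟨le_top⟩

/-- A noncompact second countable space is an increasing union of proper open subsets. -/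
lemma exists_monotone_open_cover_ne_univ (Y : Type*) [TopologicalSpace Y]
    [SecondCountableTopology Y] [NoncompactSpace Y] :
    ∃ G : ℕ → Set Y, (∀ n, IsOpen (G n)) ∧ Monotone G ∧ (∀ y, ∃ n, y ∈ G n) ∧ ∀ n, G n ≠ univ := by
  by_contra! H
  refine noncompact_univ Y (isCompact_of_finite_subcover fun {ι} U hU hcov => ?_)
  obtain ⟨T, hTc, hT⟩ := TopologicalSpace.isOpen_iUnion_countable U hU
  have hcovT : ∀ y, ∃ i ∈ T, y ∈ U i := by
    intro y
    have : y ∈ ⋃ i ∈ T, U i := hT ▸ hcov (mem_univ y)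
    simpa using this
  have hTne : T.Nonempty := by
    obtain ⟨y⟩ := nonempty_of_noncompact Y
    obtain ⟨i, hi, -⟩ := hcovT y
    exact ⟨i, hi⟩
  obtain ⟨g, rfl⟩ := hTc.exists_eq_range hTne
  obtain ⟨n, hn⟩ := H (accumulate fun k => U (g k))
    (fun n => isOpen_biUnion fun k _ => hU _) monotone_accumulate
    (fun y => by
      obtain ⟨_, ⟨n, rfl⟩, hn⟩ := hcovT y
      exact ⟨n, mem_accumulate.2 ⟨n, le_rfl, hn⟩⟩)
  classical
  refine ⟨(Finset.range (n + 1)).image g, fun y _ => ?_⟩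
  have hy : y ∈ accumulate (fun k => U (g k)) n := hn ▸ mem_univ y
  obtain ⟨k, hk, hy⟩ := mem_accumulate.1 hy
  exact mem_iUnion₂.2 ⟨g k, Finset.mem_image_of_mem g (by simpa [Nat.lt_succ_iff] using hk), hy⟩

/-- In a T1 space exhausted by proper open sets, each of them is contained in uncountably many open
sets. -/
lemma exists_injective_open_supersets {Y : Type*} [TopologicalSpace Y] [T1Space Y]
    {G : ℕ → Set Y} (hG : ∀ n, IsOpen (G n)) (hmono : Monotone G) (hcov : ∀ y, ∃ n, y ∈ G n)
    (hne : ∀ n, G n ≠ univ) (k : ℕ) :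
    ∃ W : Set ℕ → Set Y, Function.Injective W ∧ ∀ a, IsOpen (W a) ∧ G k ⊆ W a := by
  -- The points `d n ∉ G n` form an infinite set meeting each `G m` finitely, so the complement of
  -- any subset of it is open.
  choose d hd using fun n => (ne_univ_iff_exists_notMem (G n)).1 (hne n)
  have hlt : ∀ n m, d n ∈ G m → n < m := fun n m h => by
    by_contra! hmn
    exact hd n (hmono hmn h)
  have hfin : ∀ m, (range d ∩ G m).Finite := by
    intro m
    refine ((finite_lt_nat m).image d).subset ?_
    rintro _ ⟨⟨n, rfl⟩, hn⟩
    exact ⟨n, hlt n m hn, rfl⟩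
  have hinf : (range d).Infinite := by
    intro hf
    choose m hm using hcov
    obtain ⟨M, hM⟩ := (hf.image m).bddAbove
    exact hd M (hmono (hM ⟨d M, mem_range_self M, rfl⟩) (hm (d M)))
  have hinf' : (range d \ G k).Infinite := by
    intro hf
    refine hinf ((hf.union (hfin k)).subset ?_)
    rw [sdiff_union_inter]
  let u : ℕ ↪ ↥(range d \ G k) := hinf'.natEmbedding _
  let v : ℕ → Y := fun n => u n
  have hv : Function.Injective v := Subtype.val_injective.comp u.injective
  refine ⟨fun a => (v '' a)ᶜ, fun a b h => hv.image_injective (compl_injective h), fun a => ⟨?_, ?_⟩⟩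
  · rw [isOpen_iff_mem_nhds]
    intro y hy
    obtain ⟨m, hm⟩ := hcov y
    have hf : (v '' a ∩ G m).Finite := by
      refine (hfin m).subset (inter_subset_inter_left _ ?_)
      rintro _ ⟨n, -, rfl⟩
      exact (u n).2.1
    filter_upwards [(hG m).mem_nhds hm, hf.isClosed.isOpen_compl.mem_nhds fun h => hy h.1]
      with z hz hz' hzv
    exact hz' ⟨hzv, hz⟩
  · rintro y hy ⟨n, -, rfl⟩
    exact (u n).2.2 hy

lemma not_countable_set_nat : ¬ Countable (Set ℕ) := by
  intro h
  obtain ⟨f, hf⟩ := exists_injective_nat (Set ℕ)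
  exact Function.cantor_injective f hf

/-! ### Saturated codes of open sets -/

/-- The open set coded by a set of indices of a countable family. -/
def codedSet {Y : Type*} (B : ℕ → Set Y) (x : ℕ → Prop) : Set Y := {y | ∃ k, x k ∧ y ∈ B k}

/-- The saturated codes: those which list every member of the family inside the coded set. -/
def saturatedCodes {Y : Type*} (B : ℕ → Set Y) : Set (ℕ → Prop) :=
  {x | ∀ n, B n ⊆ codedSet B x → x n}

lemma isOpen_setOf_code (n : ℕ) : IsOpen {x : ℕ → Prop | x n} := by
  have := isOpen_singleton_true.preimage (continuous_apply (A := fun _ : ℕ => Prop) n)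
  convert this using 1
  ext x
  simp

lemma isOpen_setOf_mem_codedSet {Y : Type*} [TopologicalSpace Y] {B : ℕ → Set Y}
    (hB : ∀ n, IsOpen (B n)) : IsOpen {z : (ℕ → Prop) × Y | z.2 ∈ codedSet B z.1} := by
  have : {z : (ℕ → Prop) × Y | z.2 ∈ codedSet B z.1} = ⋃ k, {x | x k} ×ˢ B k := by
    ext z
    simp [codedSet]
  rw [this]
  exact isOpen_iUnion fun k => (isOpen_setOf_code k).prod (hB k)

/-- This is the tube lemma applied to the open evaluation relation. -/
lemma isOpen_setOf_subset_codedSet {Y : Type*} [TopologicalSpace Y] {B : ℕ → Set Y}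
    (hB : ∀ n, IsOpen (B n)) {K : Set Y} (hK : IsCompact K) :
    IsOpen {x : ℕ → Prop | K ⊆ codedSet B x} := by
  rw [isOpen_iff_mem_nhds]
  intro x hx
  exact hK.eventually_forall_of_forall_eventually fun y hy =>
    (isOpen_setOf_mem_codedSet hB).mem_nhds (x := (x, y)) (hx hy)

/-- Containing a given compact set is an open condition on the code. Each `B n` is Fσ in a σ-compact
space, hence a countable union of compact sets, so containing it is a Gδ condition. -/
lemma measurableSet_saturatedCodes {Y : Type*} [TopologicalSpace Y]
    [TopologicalSpace.MetrizableSpace Y] [SigmaCompactSpace Y] {B : ℕ → Set Y}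
    (hB : ∀ n, IsOpen (B n)) : MeasurableSet (saturatedCodes B) := by
  let := TopologicalSpace.metrizableSpaceMetric Y
  have hsub : ∀ n, MeasurableSet {x : ℕ → Prop | B n ⊆ codedSet B x} := by
    intro n
    obtain ⟨F, hF, -, hFB, -⟩ := (hB n).exists_iUnion_isClosed
    have : {x : ℕ → Prop | B n ⊆ codedSet B x} =
        ⋂ (j) (m), {x | F j ∩ compactCovering Y m ⊆ codedSet B x} := by
      ext x
      simp only [mem_ofPred_eq, mem_iInter]
      constructor
      · intro h j m
        exact inter_subset_left.trans ((subset_iUnion F j).trans (hFB.le.trans h))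
      · intro h y hy
        rw [← hFB] at hy
        obtain ⟨j, hj⟩ := mem_iUnion.1 hy
        obtain ⟨m, hm⟩ := exists_mem_compactCovering y
        exact h j m ⟨hj, hm⟩
    rw [this]
    exact MeasurableSet.iInter fun j => MeasurableSet.iInter fun m =>
      (isOpen_setOf_subset_codedSet hB
        ((isCompact_compactCovering Y m).inter_left (hF j))).measurableSet
  have : saturatedCodes B = ⋂ n, ({x | B n ⊆ codedSet B x}ᶜ ∪ {x | x n}) := by
    ext x
    simp only [saturatedCodes, mem_ofPred_eq, mem_iInter, mem_union, mem_compl_iff, imp_iff_not_or]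
  rw [this]
  exact MeasurableSet.iInter fun n => (hsub n).compl.union (isOpen_setOf_code n).measurableSet

/-- A neighborhood of a code contains all codes which share a certain finite part of it. -/
lemma exists_finset_of_mem_open_code {O : Set (ℕ → Prop)} (hO : IsOpen O) {x : ℕ → Prop}
    (hx : x ∈ O) : ∃ s : Finset ℕ, (∀ n ∈ s, x n) ∧ ∀ x', (∀ n ∈ s, x' n) → x' ∈ O := by
  classical
  obtain ⟨I, u, hu, hsub⟩ := isOpen_pi_iff.1 hO x hx
  refine ⟨I.filter fun n => x n, fun n hn => (Finset.mem_filter.1 hn).2, fun x' hx' => hsub ?_⟩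
  intro n hn
  by_cases hxn : x n
  · have h1 : x n = True := eq_true hxn
    have h2 : x' n = True := eq_true (hx' n (Finset.mem_filter.2 ⟨hn, hxn⟩))
    rw [h2, ← h1]
    exact (hu n hn).2
  -- The only open set containing `False` is everything, so negative information imposes no
  -- constraint.
  · have h1 : False ∈ u n := eq_false hxn ▸ (hu n hn).2
    have h2 : u n = univ := by
      simpa [nhds_false] using (hu n hn).1.mem_nhds h1
    rw [h2]
    exact mem_univ _

/-! ### The universal open set -/

/-- A σ-compact noncompact separable metrizable space has the uniquely universal property with
respect to the Baire space. -/
theorem hasUU_of_sigmaCompact_of_noncompact (Y : Type*) [TopologicalSpace Y]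
    [TopologicalSpace.MetrizableSpace Y] [SecondCountableTopology Y] [SigmaCompactSpace Y]
    [NoncompactSpace Y] : HasUU (ℕ → ℕ) Y := by
  obtain ⟨G, hG, hmono, hcov, hne⟩ := exists_monotone_open_cover_ne_univ Y
  -- Requiring each basic set to lie in some `G k` keeps every finite union of basic sets inside a
  -- single proper `G k`.
  let b : Set (Set Y) := {V | IsOpen V ∧ V ∈ TopologicalSpace.countableBasis Y ∧ ∃ k, V ⊆ G k}
  have hbasis : ∀ (y : Y) (W : Set Y), y ∈ W → IsOpen W → ∃ V ∈ b, y ∈ V ∧ V ⊆ W := by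
    intro y W hy hW
    obtain ⟨k, hk⟩ := hcov y
    obtain ⟨V, hV, hyV, hVW⟩ := (TopologicalSpace.isBasis_countableBasis Y).exists_subset_of_mem_open
      (show y ∈ W ∩ G k from ⟨hy, hk⟩) (hW.inter (hG k))
    exact ⟨V, ⟨TopologicalSpace.isOpen_of_mem_countableBasis hV, hV, k,
      hVW.trans inter_subset_right⟩, hyV, hVW.trans inter_subset_left⟩
  have hbc : b.Countable := (TopologicalSpace.countable_countableBasis Y).mono fun V hV => hV.2.1
  have hbne : b.Nonempty := by
    obtain ⟨y⟩ := nonempty_of_noncompact Y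
    obtain ⟨V, hV, -⟩ := hbasis y univ (mem_univ y) isOpen_univ
    exact ⟨V, hV⟩
  obtain ⟨B, hBb⟩ := hbc.exists_eq_range hbne
  have hBmem : ∀ n, B n ∈ b := fun n => hBb ▸ mem_range_self n
  have hB : ∀ n, IsOpen (B n) := fun n => (hBmem n).1
  have hcode : ∀ W : Set Y, IsOpen W → codedSet B (fun n => B n ⊆ W) = W := by
    intro W hW
    ext y
    constructor
    · rintro ⟨k, hk, hy⟩
      exact hk hy
    · intro hy
      obtain ⟨V, hV, hyV, hVW⟩ := hbasis y W hy hW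
      rw [hBb] at hV
      obtain ⟨n, rfl⟩ := hV
      exact ⟨n, hVW, hyV⟩
  let E : Set (ℕ → Prop) := saturatedCodes B
  let code : {W : Set Y // IsOpen W} → E := fun W => ⟨fun n => B n ⊆ W.1, fun n hn =>
    hn.trans (hcode W.1 W.2).le⟩
  have hE : MeasurableSet E := measurableSet_saturatedCodes hB
  have : StandardBorelSpace E := hE.standardBorel
  have hunc : ∀ O : Set E, IsOpen O → O.Nonempty → ¬ O.Countable := by
    rintro O hO ⟨x, hx⟩ hc
    obtain ⟨O', hO', rfl⟩ := isOpen_induced_iff.1 hO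
    obtain ⟨s, hs, hsO⟩ := exists_finset_of_mem_open_code hO' hx
    choose k hk using fun n => (hBmem n).2.2
    -- The finitely many basic sets that guarantee membership in `O'` all lie in `G (s.sup k)`, so
    -- every open superset of it has its code in `O'`.
    obtain ⟨W, hWi, hW⟩ := exists_injective_open_supersets hG hmono hcov hne (s.sup k)
    refine not_countable_set_nat (countable_univ_iff.1
      ((hc.preimage (f := fun a => code ⟨W a, (hW a).1⟩) ?_).mono fun a _ => ?_))
    · intro a a' h
      refine hWi ?_
      rw [← hcode _ (hW a).1, ← hcode _ (hW a').1]
      exact congrArg (codedSet B) (congrArg Subtype.val h)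
    · exact hsO _ fun n hn => (hk n).trans ((hmono (Finset.le_sup hn)).trans (hW a).2)
  have : Nonempty E := ⟨code ⟨univ, isOpen_univ⟩⟩
  obtain ⟨h, hh, hbij⟩ := exists_continuous_bijective_of_open_uncountable hunc
  refine ⟨{z | z.2 ∈ codedSet B (h z.1)}, ?_, fun W hW => ?_⟩
  · exact (isOpen_setOf_mem_codedSet hB).preimage
      (f := fun z : (ℕ → ℕ) × Y => ((h z.1 : ℕ → Prop), z.2)) (by fun_prop)
  · obtain ⟨x, hx⟩ := hbij.2 (code ⟨W, hW⟩)
    refine ⟨x, ?_, fun x' hx' => hbij.1 ?_⟩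
    · change codedSet B (h x) = W
      rw [hx]
      exact hcode W hW
    · change codedSet B (h x') = W at hx'
      rw [hx]
      refine Subtype.ext (funext fun n => propext ⟨fun hn => ?_, fun hn => (h x').2 n ?_⟩)
      · exact fun y hy => hx' ▸ ⟨n, hn, hy⟩
      · rw [hx']
        exact hn

/-- The Baire space is `ℕ → ℕ` and the Cantor space is `ℕ → Bool`, with the product topologies of
discrete spaces; a subset `Y` of `P` carries the subspace topology. -/
theorem mainTheorem3 :
    (∀ (P : Type*) [TopologicalSpace P] [PolishSpace P] (Y : Set P),
        IsSigmaCompact Y → ¬ IsCompact Y → HasUU (ℕ → ℕ) Y) ∧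
      HasUU (ℕ → ℕ) (ℚ × (ℕ → Bool)) := by
  constructor
  · intro P _ _ Y hY hc
    have := isSigmaCompact_iff_sigmaCompactSpace.1 hY
    have : NoncompactSpace Y := by
      rw [← not_compactSpace_iff, ← isCompact_iff_compactSpace]
      exact hc
    exact hasUU_of_sigmaCompact_of_noncompact Y
  · obtain ⟨r, hr⟩ := exists_surjective_nat ℚ
    have : SigmaCompactSpace ℚ := ⟨fun n => {r n}, fun _ => isCompact_singleton, by
      rw [iUnion_singleton_eq_range, hr.range_eq]⟩
    have : NoncompactSpace (ℚ × (ℕ → Bool)) := by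
      rw [← not_compactSpace_iff]
      intro h
      have h1 : CompactSpace ℚ := ⟨by
        rw [← range_eq_univ.2 (Prod.fst_surjective (α := ℚ) (β := ℕ → Bool))]
        exact isCompact_range continuous_fst⟩
      exact not_compactSpace_iff.2 inferInstance h1
    exact hasUU_of_sigmaCompact_of_noncompact _
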